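/- Let $n \ge 0$ be an integer and let $S$ be any scheme. Put $\mathbb{P}^n_{\mathbb{Z}} = \operatorname{Proj} \mathbb{Z}[x_0,\dots,x_n]$ with the grading by degree, $\mathbb{P}^n_S = \mathbb{P}^n_{\mathbb{Z}} \times_{\operatorname{Spec}\mathbb{Z}} S$, and let $f : \mathbb{P}^n_S \to S$ be the canonical morphism. Then the connected components of (the underlying space of) $\mathbb{P}^n_S$ are exactly the subsets $f^{-1}(C)$ with $C$ a connected component of $S$. Equivalently, the connected components of $\mathbb{P}^n_S$ are exactly the $\mathbb{P}^n_C$ with $C$ a connected component of $S$ equipped with a closed subscheme structure: for every closed immersion $i : C \to S$ whose image is a connected component of $S$, the induced morphism $\mathbb{P}^n_C \to \mathbb{P}^n_S$ is a closed immersion with image $f^{-1}(i(C))$, and the connected components of $\mathbb{P}^n_S$ are exactly the images of these closed immersions $\mathbb{P}^n_C \to \mathbb{P}^n_S$. -/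

import Mathlib

open CategoryTheory CategoryTheory.Limits AlgebraicGeometry

universe u

noncomputable section

/-- The set of connected components of a topological space `X`, as subsets of `X`
(empty if `X` is empty). -/
def connComps (X : Type u) [TopologicalSpace X] : Set (Set X) :=
  Set.range (connectedComponent : X → Set X)

attribute [local instance] MvPolynomial.gradedAlgebra in
/-- `ℙⁿ_ℤ = Proj ℤ[x₀, …, xₙ]` for the grading by degree. The ring `ULift ℤ` is `ℤ` in the
universe `u`. -/
def ProjSpaceInt (n : ℕ) : Scheme.{u} :=
  Proj (MvPolynomial.homogeneousSubmodule (Fin (n + 1)) (ULift.{u} ℤ))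

/-- `ℙⁿ_S = ℙⁿ_ℤ ×_{Spec ℤ} S`. The two maps to `Spec ℤ` are the unique ones, as `Spec ℤ` is a
terminal scheme. -/
def ProjSpace (n : ℕ) (S : Scheme.{u}) : Scheme.{u} :=
  pullback (specULiftZIsTerminal.{u}.from (ProjSpaceInt.{u} n)) (specULiftZIsTerminal.{u}.from S)

/-- The canonical morphism `ℙⁿ_S ⟶ S`. -/
def ProjSpace.toBase (n : ℕ) (S : Scheme.{u}) : ProjSpace n S ⟶ S :=
  pullback.snd _ _

/-- The morphism `ℙⁿ_C ⟶ ℙⁿ_S` induced by `i : C ⟶ S`, that is, `id ×_{Spec ℤ} i`. -/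
def ProjSpace.map (n : ℕ) {C S : Scheme.{u}} (i : C ⟶ S) : ProjSpace n C ⟶ ProjSpace n S :=
  pullback.lift (pullback.fst _ _) (pullback.snd _ _ ≫ i)
    (specULiftZIsTerminal.{u}.hom_ext _ _)

end

/-! ### Dehomogenization -/

section HomogeneousAlgebra

open MvPolynomial HomogeneousLocalization

attribute [local instance] MvPolynomial.gradedAlgebra

/-! The morphism `f` is closed and surjective with connected fibres, so topologically it is a
quotient map along which connected components pull back to connected components
(`ProjSpace.preimage_connectedComponent`). Both inputs are stable under base change, hence are
checked over `Spec ℤ`. Closedness comes from universal closedness of `Proj`. For geometric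
connectedness, the charts `D₊(xᵢ)` are geometrically irreducible, being images of the open
subschemes `xᵢ ≠ 0` of affine space, and all contain the section `(1 : ⋯ : 1)`, so their base
changes to a field share a point. -/

/-- A homogeneous polynomial of degree `n` scales by `c ^ n` when its arguments scale by `c`. -/
lemma MvPolynomial.IsHomogeneous.eval₂_const_mul {σ R A : Type*} [CommSemiring R] [CommSemiring A]
    {φ : MvPolynomial σ R} {n : ℕ} (hφ : φ.IsHomogeneous n) (g : R →+* A) (c : A) (x : σ → A) :
    MvPolynomial.eval₂ g (fun j ↦ c * x j) φ = c ^ n * MvPolynomial.eval₂ g x φ := by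
  rw [eval₂_eq, eval₂_eq, Finset.mul_sum]
  refine Finset.sum_congr rfl fun d hd ↦ ?_
  have hdeg : ∑ j ∈ d.support, d j = n := by
    by_contra h
    exact (mem_support_iff.mp hd) (hφ.coeff_eq_zero h)
  simp only [mul_pow, Finset.prod_mul_distrib, Finset.prod_pow_eq_pow_sum, hdeg]
  ring

variable {σ R : Type*} [CommRing R]

lemma MvPolynomial.algebraMap_homogeneousSubmodule_zero_surjective :
    Function.Surjective (algebraMap R (homogeneousSubmodule σ R 0)) := by
  rintro ⟨p, hp⟩
  rw [homogeneousSubmodule_zero, Submodule.mem_one] at hp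
  obtain ⟨r, rfl⟩ := hp
  exact ⟨r, rfl⟩

variable (R) in
/-- The fraction `xⱼ / xᵢ`. -/
noncomputable def coordRatio (i j : σ) : Away (homogeneousSubmodule σ R) (X i) :=
  Away.mk (homogeneousSubmodule σ R) (d := 1) (isHomogeneous_X R i) 1 (X j)
    (by simpa using isHomogeneous_X R j)

lemma algebraMap_pow_mul_val_mk (i : σ) (m : ℕ) (p : MvPolynomial σ R)
    (hi : X i ∈ homogeneousSubmodule σ R 1) (hp : p ∈ homogeneousSubmodule σ R (m • 1)) :
    algebraMap (MvPolynomial σ R) (Localization.Away (X i : MvPolynomial σ R)) (X i) ^ m *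
      (Away.mk (homogeneousSubmodule σ R) hi m p hp).val =
        algebraMap (MvPolynomial σ R) _ p := by
  rw [Away.val_mk, Localization.mk_eq_mk', ← map_pow]
  exact IsLocalization.mk'_spec' _ p (⟨X i ^ m, m, rfl⟩ : Submonoid.powers (X i))

lemma algebraMap_mul_val_coordRatio (i j : σ) :
    algebraMap (MvPolynomial σ R) (Localization.Away (X i : MvPolynomial σ R)) (X i) *
        (coordRatio R i j).val =
      algebraMap (MvPolynomial σ R) _ (X j) := by
  simpa only [pow_one, coordRatio] using algebraMap_pow_mul_val_mk i 1 (X j) (isHomogeneous_X R i)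
    (by simpa using isHomogeneous_X R j)

lemma coordRatio_self (i : σ) : coordRatio R i i = 1 := by
  apply val_injective
  have hu := IsLocalization.Away.algebraMap_isUnit (S := Localization.Away (X i : MvPolynomial σ R))
    (X i : MvPolynomial σ R)
  rw [val_one, ← hu.mul_right_inj, algebraMap_mul_val_coordRatio, mul_one]

variable (R) in
/-- Dehomogenization: the ring map `R[x]_{xᵢ} → (R[x]_{xᵢ})₀` sending `xⱼ` to `xⱼ / xᵢ`. -/
noncomputable def dehomogenize (i : σ) :
    Localization.Away (X i : MvPolynomial σ R) →+* Away (homogeneousSubmodule σ R) (X i) :=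
  Localization.awayLift
    (eval₂Hom ((fromZeroRingHom (homogeneousSubmodule σ R) _).comp (algebraMap R _))
      (coordRatio R i))
    (X i) (by simp [coordRatio_self])

/-- Homogeneity gives `xᵢ ^ m * p(x / xᵢ) = p(x)`, and `xᵢ` is a unit. This retraction makes the map
from `xᵢ ≠ 0` to `D₊(xᵢ)` surjective. -/
lemma dehomogenize_val (i : σ) (a : Away (homogeneousSubmodule σ R) (X i)) :
    dehomogenize R i a.val = a := by
  obtain ⟨m, p, hp, rfl⟩ := Away.mk_surjective _
    ((mem_homogeneousSubmodule _ _).mpr (isHomogeneous_X R i)) a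
  have hp' : p.IsHomogeneous m := by simpa using hp
  let B := Localization.Away (X i : MvPolynomial σ R)
  have hu : IsUnit (algebraMap (MvPolynomial σ R) B (X i) ^ m) :=
    (IsLocalization.Away.algebraMap_isUnit _).pow m
  have hcoeff : (algebraMap (Away (homogeneousSubmodule σ R) (X i)) B).comp
      ((fromZeroRingHom (homogeneousSubmodule σ R) _).comp (algebraMap R _)) =
      (algebraMap (MvPolynomial σ R) B).comp C := RingHom.ext fun r ↦ rfl
  -- Here `v = 1` inverts the image `xᵢ / xᵢ = 1` of `xᵢ`.
  rw [Away.val_mk, dehomogenize, Localization.awayLift_mk (v := 1) (hv := by simp [coordRatio_self]),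
    one_pow, mul_one]
  apply val_injective
  rw [← hu.mul_right_inj, algebraMap_pow_mul_val_mk, ← HomogeneousLocalization.algebraMap_apply,
    coe_eval₂Hom, hom_eval₂, hcoeff, ← hp'.eval₂_const_mul]
  refine (congr_arg (eval₂ _ · p) (funext (algebraMap_mul_val_coordRatio i))).trans ?_
  exact (hom_eval₂ p C (algebraMap _ B) X).symm.trans (congr_arg _ (eval₂_eta p))

end HomogeneousAlgebra

/-! ### Geometric irreducibility and connectedness -/

namespace AlgebraicGeometry

/-- Surjectivity survives base change, and a continuous image of an irreducible space is
irreducible. -/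
lemma GeometricallyIrreducible.of_comp_of_surjective {X Y S : Scheme.{u}} (p : Y ⟶ X) (f : X ⟶ S)
    [Surjective p] [GeometricallyIrreducible (p ≫ f)] : GeometricallyIrreducible f := by
  refine ⟨geometrically_iff_of_isClosedUnderIsomorphisms.mpr fun K _ y ↦ ?_⟩
  have : IrreducibleSpace ↥(pullback (p ≫ f) y) :=
    pullback_of_geometrically GeometricallyIrreducible.geometrically_irreducibleSpace K y
  let q : pullback (p ≫ f) y ⟶ pullback f y :=
    pullback.map _ _ _ _ p (𝟙 _) (𝟙 _) (by simp) (by simp)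
  have hq : Function.Surjective q := by
    rw [← Set.range_eq_univ, Scheme.Pullback.range_map, range_eq_univ p, range_eq_univ (𝟙 _)]
    simp
  rw [irreducibleSpace_def, Set.top_eq_univ, ← Set.image_univ_of_surjective hq]
  exact (IrreducibleSpace.isIrreducible_univ _).image _ q.continuous.continuousOn

lemma GeometricallyConnected.of_geometricallyIrreducible {X S : Scheme.{u}} (f : X ⟶ S)
    [GeometricallyIrreducible f] : GeometricallyConnected f :=
  ⟨fun _ _ y _ fst snd h ↦
    have := GeometricallyIrreducible.geometrically_irreducibleSpace (f := f) y fst snd h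
    inferInstance⟩

/-- A scheme over `S` is geometrically connected if it is covered by geometrically connected
schemes over `S` and the intersection of their images contains the image of a scheme which
surjects onto `S`. -/
lemma GeometricallyConnected.of_iUnion_range_eq_univ {X S T : Scheme.{u}} (f : X ⟶ S) {ι : Type*}
    {U : ι → Scheme.{u}} (g : ∀ i, U i ⟶ X) (hg : ⋃ i, Set.range (g i) = Set.univ)
    [∀ i, GeometricallyConnected (g i ≫ f)] (p : T ⟶ X) [Surjective (p ≫ f)]
    (hp : ∀ i, Set.range p ⊆ Set.range (g i)) : GeometricallyConnected f := by
  refine ⟨geometrically_iff_of_isClosedUnderIsomorphisms.mpr fun K _ y ↦ ?_⟩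
  have range_eq {W : Scheme.{u}} (h : W ⟶ X) :
      Set.range (pullback.map (h ≫ f) y f y h (𝟙 _) (𝟙 _) (by simp) (by simp)) =
        pullback.fst f y ⁻¹' Set.range h := by
    rw [Scheme.Pullback.range_map, range_eq_univ (𝟙 _), Set.preimage_univ, Set.inter_univ]
  obtain ⟨t, -⟩ := (pullback.snd (p ≫ f) y).surjective (Nonempty.some inferInstance)
  let x : ↥(pullback f y) := pullback.map (p ≫ f) y f y p (𝟙 _) (𝟙 _) (by simp) (by simp) t
  have hx : pullback.fst f y x ∈ Set.range p := (range_eq p).le ⟨t, rfl⟩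
  have hconn (i) : _root_.IsPreconnected (pullback.fst f y ⁻¹' Set.range (g i)) := by
    have : ConnectedSpace ↥(pullback (g i ≫ f) y) :=
      pullback_of_geometrically GeometricallyConnected.geometrically_connectedSpace K y
    rw [← range_eq]
    exact isPreconnected_range (Scheme.Hom.continuous _)
  have huniv := isPreconnected_iUnion ⟨x, Set.mem_iInter.mpr fun i ↦ hp i hx⟩ hconn
  rw [← Set.preimage_iUnion, hg, Set.preimage_univ] at huniv
  exact { isPreconnected_univ := huniv, toNonempty := ⟨x⟩ }

-- Base change to a field `K` gives the domain `K[x₁, …, xₙ]`.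
open TensorProduct in
instance geometricallyIrreducible_Spec_mvPolynomial (n : ℕ) (R : Type u) [CommRing R] :
    GeometricallyIrreducible
      (Spec.map (CommRingCat.ofHom (algebraMap R (MvPolynomial (Fin n) R)))) := by
  refine ⟨geometrically_iff_of_commRing_of_isClosedUnderIsomorphisms.mpr fun K _ _ ↦ ?_⟩
  let e := (Algebra.TensorProduct.comm R (MvPolynomial (Fin n) R) K).toRingEquiv.trans
    (MvPolynomial.algebraTensorAlgEquiv (σ := Fin n) R K).toRingEquiv
  have : IsDomain (MvPolynomial (Fin n) R ⊗[R] K) := e.toMulEquiv.isDomain _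
  exact ((pullbackSpecIso R _ K).hom.homeomorph.irreducibleSpace_iff).mpr inferInstance

end AlgebraicGeometry

/-! ### Projective space over `ℤ` -/

section Charts

open MvPolynomial HomogeneousLocalization

instance geometricallyIrreducible_Spec_away (n : ℕ) (i : Fin n) :
    GeometricallyIrreducible (specULiftZIsTerminal.{u}.from
      (Spec (.of (Localization.Away (X i : MvPolynomial (Fin n) (ULift.{u} ℤ)))))) := by
  let A := MvPolynomial (Fin n) (ULift.{u} ℤ)
  let B := Localization.Away (X i : A)
  -- The section `(1, …, 1)` shows that no fibre of the open subscheme is empty.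
  let ev : B →+* ULift.{u} ℤ := Localization.awayLift (eval fun _ ↦ 1) (X i) (by simp)
  let j : Spec (.of B) ⟶ Spec (.of A) := Spec.map (CommRingCat.ofHom (algebraMap A B))
  let g : Spec (.of A) ⟶ Spec (.of (ULift.{u} ℤ)) :=
    Spec.map (CommRingCat.ofHom (algebraMap (ULift.{u} ℤ) A))
  have : IsOpenImmersion j := inferInstanceAs (IsOpenImmersion
    (Spec.map (CommRingCat.ofHom (algebraMap A (Localization.Away (X i : A))))))
  have : GeometricallyIrreducible g := inferInstance
  have hid : Spec.map (CommRingCat.ofHom ev) ≫ j ≫ g = 𝟙 _ := specULiftZIsTerminal.hom_ext _ _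
  have : Surjective (Spec.map (CommRingCat.ofHom ev) ≫ j ≫ g) := hid ▸ inferInstance
  have : Surjective (j ≫ g) := .of_comp (Spec.map (CommRingCat.ofHom ev)) _
  rw [specULiftZIsTerminal.hom_ext (specULiftZIsTerminal.{u}.from _) (j ≫ g)]
  infer_instance

attribute [local instance] MvPolynomial.gradedAlgebra

instance geometricallyIrreducible_Spec_homogeneousAway (n : ℕ) (i : Fin n) :
    GeometricallyIrreducible (specULiftZIsTerminal.{u}.from
      (Spec (.of (Away (homogeneousSubmodule (Fin n) (ULift.{u} ℤ)) (X i))))) := by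
  let q := Spec.map (CommRingCat.ofHom
    (algebraMap (Away (homogeneousSubmodule (Fin n) (ULift.{u} ℤ)) (X i))
      (Localization.Away (X i : MvPolynomial (Fin n) (ULift.{u} ℤ)))))
  have hid : Spec.map (CommRingCat.ofHom (dehomogenize (ULift.{u} ℤ) i)) ≫ q = 𝟙 _ := by
    rw [← Spec.map_comp, ← CommRingCat.ofHom_comp,
      show (dehomogenize (ULift.{u} ℤ) i).comp (algebraMap _ _) = RingHom.id _ from
        RingHom.ext (dehomogenize_val i)]
    simp
  have : Surjective (Spec.map (CommRingCat.ofHom (dehomogenize (ULift.{u} ℤ) i)) ≫ q) :=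
    hid ▸ inferInstance
  have : Surjective q := .of_comp (Spec.map (CommRingCat.ofHom (dehomogenize (ULift.{u} ℤ) i))) _
  have : GeometricallyIrreducible (q ≫ specULiftZIsTerminal.{u}.from _) := by
    rw [specULiftZIsTerminal.hom_ext (q ≫ _) (specULiftZIsTerminal.{u}.from _)]
    infer_instance
  exact .of_comp_of_surjective q _

variable (n : ℕ)

lemma MvPolynomial.prod_X_mem_homogeneousSubmodule (R : Type*) [CommRing R] :
    ∏ i, X i ∈ homogeneousSubmodule (Fin (n + 1)) R (n + 1) := by
  simpa using IsHomogeneous.prod Finset.univ _ (fun _ ↦ 1)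
    fun (i : Fin (n + 1)) _ ↦ isHomogeneous_X R i

/-- The point `(1 : ⋯ : 1)` of projective space. -/
noncomputable def onesPoint : Spec (.of (ULift.{u} ℤ)) ⟶
    Proj (homogeneousSubmodule (Fin (n + 1)) (ULift.{u} ℤ)) :=
  Spec.map (CommRingCat.ofHom ((Localization.awayLift (eval (fun _ ↦ 1)) (∏ i, X i) (by simp)).comp
    (algebraMap (Away (homogeneousSubmodule (Fin (n + 1)) (ULift.{u} ℤ)) (∏ i, X i))
      (Localization.Away (∏ i, X i : MvPolynomial (Fin (n + 1)) (ULift.{u} ℤ)))))) ≫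
  Proj.awayι _ _ (prod_X_mem_homogeneousSubmodule n _) n.succ_pos

/-- The standard chart `D₊(xᵢ)` of projective space. -/
noncomputable def projChart (i : Fin (n + 1)) :
    Spec (.of (Away (homogeneousSubmodule (Fin (n + 1)) (ULift.{u} ℤ)) (X i))) ⟶
      Proj (homogeneousSubmodule (Fin (n + 1)) (ULift.{u} ℤ)) :=
  Proj.awayι _ _ ((mem_homogeneousSubmodule _ _).mpr (isHomogeneous_X _ i)) one_pos

lemma range_projChart (i : Fin (n + 1)) :
    Set.range (projChart.{u} n i) =
      (Proj.basicOpen (homogeneousSubmodule (Fin (n + 1)) (ULift.{u} ℤ)) (X i) : Set _) :=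
  congr_arg SetLike.coe (Proj.opensRange_awayι _ _ _ _)

lemma range_onesPoint_subset (i : Fin (n + 1)) :
    Set.range (onesPoint.{u} n) ⊆ Set.range (projChart.{u} n i) := by
  rw [range_projChart]
  rintro _ ⟨z, rfl⟩
  -- The point lies in `D₊(∏ xᵢ)`, which is inside every chart.
  refine Proj.basicOpen_mono _ _ (∏ i, X i) (Finset.dvd_prod_of_mem _ (Finset.mem_univ i)) ?_
  rw [onesPoint, Scheme.Hom.comp_apply,
    ← Proj.opensRange_awayι _ _ (prod_X_mem_homogeneousSubmodule n _) n.succ_pos]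
  exact ⟨_, rfl⟩

lemma iUnion_range_projChart : ⋃ i, Set.range (projChart.{u} n i) = Set.univ := by
  have h := Proj.iSup_basicOpen_eq_top' (homogeneousSubmodule (Fin (n + 1)) (ULift.{u} ℤ)) X
    (fun i ↦ ⟨1, isHomogeneous_X _ i⟩) (by
      rw [eq_top_iff]
      rintro p -
      induction p using MvPolynomial.induction_on with
      | C r => exact Subalgebra.algebraMap_mem _ (algebraMap (ULift.{u} ℤ)
          (homogeneousSubmodule (Fin (n + 1)) (ULift.{u} ℤ) 0) r)
      | add p q hp hq => exact add_mem hp hq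
      | mul_X p i hp => exact mul_mem hp (Algebra.subset_adjoin ⟨i, rfl⟩))
  simp_rw [range_projChart]
  simpa using! congr_arg SetLike.coe h

instance geometricallyConnected_projSpaceInt :
    GeometricallyConnected (specULiftZIsTerminal.{u}.from (ProjSpaceInt.{u} n)) := by
  change GeometricallyConnected (specULiftZIsTerminal.{u}.from
    (Proj (homogeneousSubmodule (Fin (n + 1)) (ULift.{u} ℤ))))
  have (i : Fin (n + 1)) : GeometricallyConnected
      (projChart.{u} n i ≫ specULiftZIsTerminal.{u}.from _) := by
    rw [specULiftZIsTerminal.hom_ext (projChart.{u} n i ≫ _) (specULiftZIsTerminal.{u}.from _)]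
    exact .of_geometricallyIrreducible _
  have : Surjective (onesPoint.{u} n ≫ specULiftZIsTerminal.{u}.from _) := by
    rw [specULiftZIsTerminal.hom_ext (onesPoint.{u} n ≫ _) (𝟙 _)]
    infer_instance
  exact .of_iUnion_range_eq_univ _ _ (iUnion_range_projChart n) (onesPoint n)
    (range_onesPoint_subset n)

/-- `Proj` is universally closed over `Spec 𝒜₀`, which is closed in `Spec R`. -/
lemma universallyClosed_toSpecZero_comp {R A : Type u} [CommRing R] [CommRing A] [Algebra R A]
    (𝒜 : ℕ → Submodule R A) [GradedAlgebra 𝒜] [Algebra.FiniteType R A]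
    (h : Function.Surjective (algebraMap R (𝒜 0))) :
    UniversallyClosed (Proj.toSpecZero 𝒜 ≫ Spec.map (CommRingCat.ofHom (algebraMap R (𝒜 0)))) := by
  have : Algebra.FiniteType (𝒜 0) A :=
    @Algebra.FiniteType.of_restrictScalars_finiteType R (𝒜 0) A _ _ _ _ _ _
      (.of_algebraMap_eq fun _ ↦ rfl) _
  have : IsClosedImmersion (Spec.map (CommRingCat.ofHom (algebraMap R (𝒜 0)))) :=
    IsClosedImmersion.spec_of_surjective _ h
  infer_instance

instance universallyClosed_projSpaceInt :
    UniversallyClosed (specULiftZIsTerminal.{u}.from (ProjSpaceInt.{u} n)) := by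
  rw [specULiftZIsTerminal.hom_ext (specULiftZIsTerminal.{u}.from (ProjSpaceInt.{u} n))
    (Proj.toSpecZero (homogeneousSubmodule (Fin (n + 1)) (ULift.{u} ℤ)) ≫
      Spec.map (CommRingCat.ofHom (algebraMap (ULift.{u} ℤ) _)))]
  exact universallyClosed_toSpecZero_comp _ algebraMap_homogeneousSubmodule_zero_surjective

end Charts

/-! ### Connected components over an arbitrary base -/

instance (n : ℕ) (S : Scheme.{u}) : GeometricallyConnected (ProjSpace.toBase n S) :=
  MorphismProperty.of_isPullback (IsPullback.of_hasPullback _ _) (geometricallyConnected_projSpaceInt n)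

instance (n : ℕ) (S : Scheme.{u}) : UniversallyClosed (ProjSpace.toBase n S) :=
  MorphismProperty.of_isPullback (IsPullback.of_hasPullback _ _) (universallyClosed_projSpaceInt n)

lemma ProjSpace.preimage_connectedComponent (n : ℕ) (S : Scheme.{u}) (x : ProjSpace n S) :
    ProjSpace.toBase n S ⁻¹' connectedComponent (ProjSpace.toBase n S x) =
      connectedComponent x :=
  ((ProjSpace.toBase n S).isClosedMap.isQuotientMap (ProjSpace.toBase n S).continuous
    (ProjSpace.toBase n S).surjective).isCoinducing.preimage_connectedComponent
    (ProjSpace.toBase n S).isConnected_preimage_singleton x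

lemma ProjSpace.connComps_eq (n : ℕ) (S : Scheme.{u}) :
    connComps (ProjSpace n S) = {Z | ∃ C ∈ connComps S, Z = (ProjSpace.toBase n S) ⁻¹' C} := by
  ext Z
  constructor
  · rintro ⟨x, rfl⟩
    exact ⟨_, ⟨_, rfl⟩, (preimage_connectedComponent n S x).symm⟩
  · rintro ⟨_, ⟨s, rfl⟩, rfl⟩
    obtain ⟨x, rfl⟩ := (ProjSpace.toBase n S).surjective s
    exact ⟨x, (preimage_connectedComponent n S x).symm⟩

lemma ProjSpace.isPullback_map (n : ℕ) {C S : Scheme.{u}} (i : C ⟶ S) :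
    IsPullback (ProjSpace.map n i) (ProjSpace.toBase n C) (ProjSpace.toBase n S) i := by
  refine .of_right ?_ (pullback.lift_snd _ _ _) (IsPullback.of_hasPullback _ _)
  have hfst : ProjSpace.map n i ≫ pullback.fst _ _ = pullback.fst _ _ := pullback.lift_fst _ _ _
  rw [hfst, specULiftZIsTerminal.hom_ext (i ≫ specULiftZIsTerminal.from S)
    (specULiftZIsTerminal.from C)]
  exact IsPullback.of_hasPullback _ _

lemma ProjSpace.range_map (n : ℕ) {C S : Scheme.{u}} (i : C ⟶ S) :
    Set.range (ProjSpace.map n i) = ProjSpace.toBase n S ⁻¹' Set.range i := by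
  rw [← (isPullback_map n i).isoPullback_hom_fst, ← Scheme.Pullback.range_fst]
  exact range_eq_range_of_surjective _ _ (isPullback_map n i).isoPullback.hom rfl

lemma exists_isClosedImmersion_range_eq {S : Scheme.{u}} {Z : Set S} (hZ : IsClosed Z) :
    ∃ (C : Scheme.{u}) (i : C ⟶ S), IsClosedImmersion i ∧ Set.range i = Z :=
  ⟨_, (Scheme.IdealSheafData.vanishingIdeal ⟨Z, hZ⟩).subschemeι, inferInstance, by
    rw [Scheme.IdealSheafData.range_subschemeι]; simp⟩

theorem theorem4p6 (n : ℕ) (S : Scheme.{u}) :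
    -- the connected components of `ℙⁿ_S` are exactly the sets `f⁻¹(C)`
    connComps (ProjSpace n S) =
      {Z | ∃ C ∈ connComps S, Z = (ProjSpace.toBase n S) ⁻¹' C} ∧
    -- for every closed subscheme structure on a connected component `C` of `S`, `ℙⁿ_C` is a
    -- closed subscheme of `ℙⁿ_S` with underlying set `f⁻¹(C)`
    (∀ (C : Scheme.{u}) (i : C ⟶ S), IsClosedImmersion i → Set.range i ∈ connComps S →
      IsClosedImmersion (ProjSpace.map n i) ∧
        Set.range (ProjSpace.map n i) = (ProjSpace.toBase n S) ⁻¹' (Set.range i)) ∧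
    -- the connected components of `ℙⁿ_S` are exactly the `ℙⁿ_C`
    connComps (ProjSpace n S) =
      {Z | ∃ (C : Scheme.{u}) (i : C ⟶ S), IsClosedImmersion i ∧ Set.range i ∈ connComps S ∧
        Z = Set.range (ProjSpace.map n i)} := by
  refine ⟨ProjSpace.connComps_eq n S, fun C i hi _ ↦
    ⟨MorphismProperty.of_isPullback (ProjSpace.isPullback_map n i).flip hi,
      ProjSpace.range_map n i⟩, ?_⟩
  rw [ProjSpace.connComps_eq]
  ext Z
  constructor
  · rintro ⟨C, hC, rfl⟩
    have hclosed : IsClosed C := by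
      obtain ⟨s, rfl⟩ := hC
      exact isClosed_connectedComponent
    obtain ⟨C', i, hi, rfl⟩ := exists_isClosedImmersion_range_eq hclosed
    exact ⟨C', i, hi, hC, (ProjSpace.range_map n i).symm⟩
  · rintro ⟨C, i, _, hC, rfl⟩
    exact ⟨_, hC, ProjSpace.range_map n i⟩
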